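/- Let $\overrightarrow{T}$ be a finite rooted directed tree with vertex set $\mathcal V$ whose edges all point towards the root $r$: every vertex $u\neq r$ has exactly one outgoing edge, to a vertex $u_{out}$, the root has none, and every vertex has a directed path to $r$. Let $\mathit{In}(u)=\{v : v_{out}=u\}$, and let $\mathit{Child}(u)$ be the set of all vertices with a directed path to $u$, including $u$ itself. Let $X_{\mathcal V}=(X_u)_{u\in\mathcal V}$ be jointly distributed random variables, $X_u$ taking values in a finite set $\mathcal X_u$, and let $f:\prod_{u\in\mathcal V}\mathcal X_u\to\mathcal F$ be a function. For real numbers $(R_u)_{u\ne r}$, a $((2^{nR_u})_{u\ne r},n)$ code consists of encoding functions $\varphi_u:\mathcal X_u^n\times\prod_{v\in \mathit{In}(u)}\{1,\dots,\lfloor 2^{nR_v}\rfloor\}\to\{1,\dots,\lfloor 2^{nR_u}\rfloor\}$ for $u\neq r$ and a decoding function $\psi:\mathcal X_r^n\times\prod_{v\in \mathit{In}(r)}\{1,\dots,\lfloor 2^{nR_v}\rfloor\}\to\mathcal F^n$. Given $n$ independent copies of $X_{\mathcal V}$, each vertex $u\ne r$ sends to $u_{out}$ the value of $\varphi_u$ at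 its own source block and the messages received from $\mathit{In}(u)$; the error probability is the probability that the output of $\psi$ at the root differs from the block of the $n$ values of $f$. The tuple $(R_u)_{u\neq r}$ is achievable if for every $\varepsilon>0$ and all sufficiently large $n$ there is such a code with error probability at most $\varepsilon$. For $\mathcal S\subseteq\mathcal V$ and $\mathcal S^c=\mathcal V\setminus\mathcal S$, write $L=X_{\mathcal S}=(X_u)_{u\in\mathcal S}$ and $K=X_{\mathcal S^c}$. The conditional characteristic graph $G_{X_{\mathcal S}|X_{\mathcal S^c}}$ has vertex set $\prod_{u\in\mathcal S}\mathcal X_u$, and $l_1,l_2$ are adjacent if for some $k\in\prod_{u\in\mathcal S^c}\mathcal X_u$ both $(l_1,k)$ and $(l_2,k)$ have positive probability under the law of $(X_{\mathcal S},X_{\mathcal S^c})$ and $f(l_1,k)\ne f(l_2,k)$. The conditional graph entropy is $$H(G_{X_{\mathcal S}|X_{\mathcal S^c}})=\min I(V;X_{\mathcal S}\,|\,X_{\mathcal S^c})\quad\text{(in bits)},$$ where the minimum is over all random variables $V$ that take values in a finite multiset of independent sets of $G_{X_{\mathcal S}|X_{\mathcal S^c}}$, such that $V - X_{\mathcal S}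 - X_{\mathcal S^c}$ is a Markov chain and $X_{\mathcal S}\in V$ with probability one. **Theorem (Outer Bound).** If the rate tuple $(R_u)_{u\ne r}$ is achievable, then for every valid cut $\mathcal S$, that is, every proper subset $\mathcal S\subsetneq\mathcal V$ such that $\mathit{Child}(u)\subseteq\mathcal S$ for all $u\in\mathcal S$, $$\sum_{v\in\mathcal S:\ v_{out}\in\mathcal S^c}R_v\ \ge\ H(G_{X_{\mathcal S}|X_{\mathcal S^c}}).$$ -/

import Mathlib

/-! ### Laws of random variables on finite sets

A probability law on a finite set `Ω` is an element of `stdSimplex ℝ Ω`. -/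

section FiniteLaws

variable {Ω A L K M : Type*} [Fintype Ω] [Fintype L] [Fintype K] [Fintype M]

open Classical in
/-- The law of the random variable `Z : Ω → A` when the outcome in `Ω` has law `q`. -/
noncomputable def lawOf (q : Ω → ℝ) (Z : Ω → A) (a : A) : ℝ :=
  ∑ ω with Z ω = a, q ω

/-- The conditional mutual information `I(V; L | K)`, in bits, when `(V, L, K)` has law `q`.
Terms with `q (v, l, k) = 0` vanish, and in all others no argument of the logarithm and no
denominator is zero. -/
noncomputable def condMutualInfo (q : M × L × K → ℝ) : ℝ :=
  ∑ v, ∑ l, ∑ k, q (v, l, k) *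
    Real.logb 2 ((q (v, l, k) * lawOf q (fun w => w.2.2) k) /
      (lawOf q (fun w => (w.1, w.2.2)) (v, k) * lawOf q (fun w => w.2) (l, k)))

/-- `V - L - K` is a Markov chain when `(V, L, K)` has law `q`:
`q(v, l, k) q(l) = q(v, l) q(l, k)`. -/
def IsMarkovChain (q : M × L × K → ℝ) : Prop :=
  ∀ v l k, q (v, l, k) * lawOf q (fun w => w.2.1) l =
    lawOf q (fun w => (w.1, w.2.1)) (v, l) * lawOf q (fun w => w.2) (l, k)

end FiniteLaws

/-! ### Conditional characteristic graph and conditional graph entropy -/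

section GraphEntropy

variable {L K S F : Type*}

/-- The conditional characteristic graph `G_{L|K}(f)` of `L` given `K` with respect to `f(S)`,
when `(L, K, S)` has law `p`. If `f(S)` is a function of `(L, K)` almost surely, then the
condition `l₁ ≠ l₂` follows from the other ones. -/
def condCharGraph (p : L × K × S → ℝ) (f : S → F) : SimpleGraph L where
  Adj l₁ l₂ := l₁ ≠ l₂ ∧ ∃ (k : K) (s₁ s₂ : S), 0 < p (l₁, k, s₁) * p (l₂, k, s₂) ∧ f s₁ ≠ f s₂
  symm := ⟨by
    rintro l₁ l₂ ⟨hne, k, s₁, s₂, hp, hf⟩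
    exact ⟨hne.symm, k, s₂, s₁, by rwa [mul_comm], hf.symm⟩⟩
  loopless := ⟨fun _ h => h.1 rfl⟩

variable [Fintype L] [Fintype K] [Fintype S]

/-- The conditional graph entropy `H(G_{L|K}(f))`, in bits: the minimum of `I(V; L | K)` over all
`V` such that `V - L - K` is a Markov chain, `V` ranges over a finite multiset
`{W 0, …, W (m - 1)}` of independent sets of `G_{L|K}(f)`, and `L ∈ V` almost surely. -/
noncomputable def condGraphEntropy (p : L × K × S → ℝ) (f : S → F) : ℝ :=
  sInf {I : ℝ | ∃ (m : ℕ) (W : Fin m → Set L) (q : Fin m × L × K → ℝ),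
    (∀ t, (condCharGraph p f).IsIndepSet (W t)) ∧
    q ∈ stdSimplex ℝ (Fin m × L × K) ∧
    lawOf q (fun w => w.2) = lawOf p (fun w => (w.1, w.2.1)) ∧
    IsMarkovChain q ∧
    (∀ t l k, 0 < q (t, l, k) → l ∈ W t) ∧
    I = condMutualInfo q}

end GraphEntropy

/-! ### Rooted directed trees -/

/-- A directed tree on `V` whose edges all point towards the root: the edges are
`u ⟶ out u`, one for each vertex `u` other than the root, and there is a directed
path from every vertex to the root. -/
structure RootedDirectedTree (V : Type*) where
  /-- the root -/
  root : V
  /-- the unique vertex that `u` points to -/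
  out : {u : V // u ≠ root} → V
  /-- every vertex has a directed path to the root -/
  path_root : ∀ u : V,
    Relation.ReflTransGen (fun a b => ∃ h : a ≠ root, out ⟨a, h⟩ = b) u root

namespace RootedDirectedTree

variable {V : Type*} (T : RootedDirectedTree V)

/-- The vertices other than the root. -/
abbrev NonRoot : Type _ := {u : V // u ≠ T.root}

/-- `T.Edge a b`: there is a directed edge from `a` to `b`. -/
def Edge (a b : V) : Prop := ∃ h : a ≠ T.root, T.out ⟨a, h⟩ = b

/-- The incoming neighbours of `u`. -/
abbrev In (u : V) : Type _ := {v : T.NonRoot // T.out v = u}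

/-- The vertices with a directed path to `u`, including `u` itself. -/
def Child (u : V) : Set V := {v | Relation.ReflTransGen T.Edge v u}

theorem not_transGen_edge_self (u : V) : ¬ Relation.TransGen T.Edge u u := by
  have h : Relation.ReflTransGen T.Edge u T.root := T.path_root u
  induction h using Relation.ReflTransGen.head_induction_on with
  | refl =>
    intro hc
    obtain ⟨c, ⟨h, -⟩, -⟩ := Relation.TransGen.head'_iff.1 hc
    exact h rfl
  | head hab _ ih =>
    intro hc
    obtain ⟨c, ⟨h, rfl⟩, hca⟩ := Relation.TransGen.head'_iff.1 hc
    obtain ⟨h', rfl⟩ := hab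
    exact ih (Relation.TransGen.tail' hca ⟨h', rfl⟩)

theorem wellFounded_edge [Finite V] : WellFounded T.Edge := by
  have : Std.Irrefl (Relation.TransGen T.Edge) := ⟨T.not_transGen_edge_self⟩
  exact Subrelation.wf (fun h => Relation.TransGen.single h)
    (Finite.wellFounded_of_trans_of_irrefl (Relation.TransGen T.Edge))

end RootedDirectedTree

/-! ### Codes and achievable rates -/

/-- The message set `{1, …, 2 ^ (n R)}`, that is, a set with `⌊2 ^ (n R)⌋` elements. -/
abbrev MsgSet (n : ℕ) (R : ℝ) : Type := Fin ⌊(2 : ℝ) ^ ((n : ℝ) * R)⌋₊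

/-- A `((2 ^ (n R u))_{u ≠ r}, n)` code: an encoding function at every vertex other than the
root, and a decoding function at the root. -/
structure TreeCode {V : Type*} (T : RootedDirectedTree V) (X : V → Type*) (F : Type*)
    (R : T.NonRoot → ℝ) (n : ℕ) where
  /-- the encoding functions -/
  enc : ∀ u : T.NonRoot,
    (Fin n → X u.1) → (∀ v : T.In u.1, MsgSet n (R v.1)) → MsgSet n (R u)
  /-- the decoding function -/
  dec : (Fin n → X T.root) → (∀ v : T.In T.root, MsgSet n (R v.1)) → (Fin n → F)

namespace TreeCode

variable {V : Type*} {T : RootedDirectedTree V} {X : V → Type*} {F : Type*}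
  {R : T.NonRoot → ℝ} {n : ℕ}

/-- The message sent by the vertex `u` to `out u` when the `i`-th instance of the sources is
`x i`: its encoding function applied to its own source block and to the messages received from
its incoming neighbours. -/
noncomputable def msg [Finite V] (c : TreeCode T X F R n) (x : Fin n → ∀ u, X u) (u : T.NonRoot) :
    MsgSet n (R u) :=
  c.enc u (fun i => x i u.1) (fun v => c.msg x v.1)
termination_by T.wellFounded_edge.wrap u.1
decreasing_by exact ⟨v.1.2, v.2⟩

/-- The output of the decoder at the root. -/
noncomputable def output [Finite V] (c : TreeCode T X F R n) (x : Fin n → ∀ u, X u) : Fin n → F :=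
  c.dec (fun i => x i T.root) (fun v => c.msg x v.1)

end TreeCode

section Achievability

variable {V : Type*} [Fintype V] [DecidableEq V] {T : RootedDirectedTree V}
  {X : V → Type*} [∀ u, Fintype (X u)] {F : Type*}

open Classical in
/-- The block error probability of a code: the probability that the output of the decoder
differs from the block of the values of `f`, for `n` independent instances of the sources with
law `p`. -/
noncomputable def TreeCode.errorProb {R : T.NonRoot → ℝ} {n : ℕ} (c : TreeCode T X F R n)
    (p : (∀ u, X u) → ℝ) (f : (∀ u, X u) → F) : ℝ :=
  ∑ x : Fin n → ∀ u, X u with c.output x ≠ (fun i => f (x i)), ∏ i, p (x i)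

/-- The rate tuple `R` is achievable for computing `f` at the root of `T` when the sources have
law `p`. -/
def IsAchievable (T : RootedDirectedTree V) (p : (∀ u, X u) → ℝ) (f : (∀ u, X u) → F)
    (R : T.NonRoot → ℝ) : Prop :=
  ∀ ε : ℝ, 0 < ε → ∃ n₀ : ℕ, ∀ n : ℕ, n₀ ≤ n →
    ∃ c : TreeCode T X F R n, c.errorProb p f ≤ ε

/-- The law of `(X_S, X_{Sᶜ}, X_V)` when `X_V` has law `p`. -/
noncomputable def cutLaw (p : (∀ u, X u) → ℝ) (S : Finset V) :
    (∀ u : {u : V // u ∈ S}, X u.1) × (∀ u : {u : V // u ∉ S}, X u.1) × (∀ u, X u) → ℝ :=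
  lawOf p (fun x => (fun u => x u.1, fun u => x u.1, x))

/-- A valid cut: a proper subset of the vertex set that contains `Child u` with every `u`. -/
def IsValidCut (T : RootedDirectedTree V) (S : Finset V) : Prop :=
  S ⊂ Finset.univ ∧ ∀ u ∈ S, T.Child u ⊆ (S : Set V)

end Achievability

/-! ### Entropies of random variables on a finite probability space -/

section Entropy

variable {Ω A B C : Type*} [Fintype Ω] {q : Ω → ℝ}

/-! A valid cut omits the root, messages leaving it depend only on `X_S`, and the output depends
only on these messages `m` and the blocks outside `S`. Hence the tree reduces to one sender with
block X and a receiver with side information Y (`exists_mul_condGraphEntropy_le`).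

For each position i let U be `m` together with all Y_j, j ≠ i. Then U - X_i - Y_i is a Markov chain
(`isMarkovChain_iidLaw`) and (U, Y_i) determines the i-th output, so the single-letter bound
`exists_condGraphEntropy_le_add` gives H(G) ≤ I(U; X_i | Y_i) + η. Summing over i, with
subadditivity of conditional entropy and the i.i.d. law, the informations total at most H(m | Y^n) ≤
log |M|, which is at most n times the sum of the cut rates. Dividing by n and letting η tend to 0
finishes.

The single-letter bound must turn a small error into membership with probability one. The values of
X on which the estimate from U never errs form an independent set; when X lies outside it, the
singleton {X} is used instead. The Markov property makes this exception rare
(`mul_prob_notMem_errorFreeSet_le`), so recording it costs little entropy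
(`exists_entropy_option_le`). -/

theorem lawOf_nonneg (hq : ∀ ω, 0 ≤ q ω) (Z : Ω → A) (a : A) : 0 ≤ lawOf q Z a :=
  Finset.sum_nonneg fun _ _ => hq _

theorem le_lawOf_self (hq : ∀ ω, 0 ≤ q ω) (Z : Ω → A) (ω : Ω) : q ω ≤ lawOf q Z (Z ω) := by
  classical
  unfold lawOf
  exact Finset.single_le_sum (f := q) (fun _ _ => hq _) (by simp)

theorem lawOf_pos (hq : ∀ ω, 0 ≤ q ω) (Z : Ω → A) {ω : Ω} (h : 0 < q ω) :
    0 < lawOf q Z (Z ω) := h.trans_le (le_lawOf_self hq Z ω)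

theorem exists_of_lawOf_pos (hq : ∀ ω, 0 ≤ q ω) {Z : Ω → A} {a : A} (h : 0 < lawOf q Z a) :
    ∃ ω, Z ω = a ∧ 0 < q ω := by
  classical
  unfold lawOf at h
  obtain ⟨ω, hω, hne⟩ := Finset.exists_ne_zero_of_sum_ne_zero h.ne'
  exact ⟨ω, (Finset.mem_filter.1 hω).2, lt_of_le_of_ne (hq ω) hne.symm⟩

theorem lawOf_le_lawOf (hq : ∀ ω, 0 ≤ q ω) {Z : Ω → A} {W : Ω → B} {a : A} {b : B}
    (h : ∀ ω, Z ω = a → W ω = b) : lawOf q Z a ≤ lawOf q W b := by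
  classical
  unfold lawOf
  refine Finset.sum_le_sum_of_subset_of_nonneg ?_ fun _ _ _ => hq _
  intro ω
  simpa using h ω

theorem lawOf_congr {Z : Ω → A} {W : Ω → B} {a : A} {b : B}
    (h : ∀ ω, Z ω = a ↔ W ω = b) : lawOf q Z a = lawOf q W b := by
  classical
  unfold lawOf
  congr 1
  ext ω
  simpa using h ω

theorem lawOf_eq_zero {Z : Ω → A} {a : A} (h : ∀ ω, Z ω ≠ a) : lawOf q Z a = 0 := by
  classical
  unfold lawOf
  rw [Finset.filter_eq_empty_iff.2 (fun ω _ => h ω), Finset.sum_empty]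

open Classical in
theorem lawOf_eq_sum_ite (Z : Ω → A) (a : A) :
    lawOf q Z a = ∑ ω, if Z ω = a then q ω else 0 := by
  unfold lawOf
  rw [Finset.sum_filter]

theorem sum_lawOf_mul [Fintype A] (Z : Ω → A) (G : A → ℝ) :
    ∑ a, lawOf q Z a * G a = ∑ ω, q ω * G (Z ω) := by
  classical
  simp_rw [lawOf_eq_sum_ite, Finset.sum_mul]
  rw [Finset.sum_comm]
  refine Finset.sum_congr rfl fun ω _ => ?_
  simp [ite_mul]

theorem sum_lawOf [Fintype A] (Z : Ω → A) : ∑ a, lawOf q Z a = ∑ ω, q ω := by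
  simpa using sum_lawOf_mul (q := q) Z fun _ => 1

theorem lawOf_lawOf [Fintype A] (Z : Ω → A) (g : A → B) (b : B) :
    lawOf (lawOf q Z) g b = lawOf q (fun ω => g (Z ω)) b := by
  classical
  have := sum_lawOf_mul (q := q) Z fun a => if g a = b then 1 else 0
  simpa [lawOf_eq_sum_ite (q := lawOf q Z), lawOf_eq_sum_ite (Z := fun ω => g (Z ω))] using this

theorem lawOf_equiv {Ω' : Type*} [Fintype Ω'] (e : Ω' ≃ Ω) (Z : Ω → A) (a : A) :
    lawOf q Z a = lawOf (fun w => q (e w)) (fun w => Z (e w)) a := by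
  classical
  rw [lawOf_eq_sum_ite, lawOf_eq_sum_ite, ← e.sum_comp]

theorem lawOf_id (a : Ω) : lawOf q (fun ω => ω) a = q a := by
  classical
  simp [lawOf_eq_sum_ite]

theorem sum_lawOf_prod_left [Fintype A] (Z : Ω → A) (W : Ω → B) (b : B) :
    ∑ a, lawOf q (fun ω => (Z ω, W ω)) (a, b) = lawOf q W b := by
  classical
  simp_rw [lawOf_eq_sum_ite, Prod.mk.injEq]
  rw [Finset.sum_comm]
  refine Finset.sum_congr rfl fun ω _ => ?_
  simp [ite_and]

theorem lawOf_mem_stdSimplex [Fintype A] (hq : q ∈ stdSimplex ℝ Ω) (Z : Ω → A) :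
    lawOf q Z ∈ stdSimplex ℝ A :=
  ⟨lawOf_nonneg hq.1 Z, (sum_lawOf Z).trans hq.2⟩

/-- The entropy, in nats, of the random variable `Z` when the outcome has law `q`. -/
noncomputable def entropy (q : Ω → ℝ) (Z : Ω → A) : ℝ :=
  -∑ ω, q ω * Real.log (lawOf q Z (Z ω))

theorem entropy_eq_sum_negMulLog [Fintype A] (Z : Ω → A) :
    entropy q Z = ∑ a, Real.negMulLog (lawOf q Z a) := by
  rw [entropy, ← sum_lawOf_mul Z fun a => Real.log (lawOf q Z a), ← Finset.sum_neg_distrib]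
  simp [Real.negMulLog]

/-- Each event fixing `Z` is contained in the event fixing `W`, so the logarithms compare pointwise.
-/
theorem entropy_le_of_factors (hq : ∀ ω, 0 ≤ q ω) {Z : Ω → A} {W : Ω → B}
    (h : ∀ ω ω', Z ω = Z ω' → W ω = W ω') : entropy q W ≤ entropy q Z := by
  unfold entropy
  refine neg_le_neg (Finset.sum_le_sum fun ω _ => ?_)
  rcases (hq ω).eq_or_lt with h0 | h0
  · simp [← h0]
  · exact mul_le_mul_of_nonneg_left (Real.log_le_log (lawOf_pos hq Z h0)
      (lawOf_le_lawOf hq fun ω' hω' => h _ _ hω')) h0.le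

theorem entropy_eq_of_iff (hq : ∀ ω, 0 ≤ q ω) {Z : Ω → A} {W : Ω → B}
    (h : ∀ ω ω', Z ω = Z ω' ↔ W ω = W ω') : entropy q W = entropy q Z :=
  le_antisymm (entropy_le_of_factors hq fun _ _ => (h _ _).1)
    (entropy_le_of_factors hq fun _ _ => (h _ _).2)

/-- This is nonnegativity of I(X; Y | Z): apply log t ≤ t - 1 to the ratio p(x,z) p(y,z) / (p(x,y,z)
p(z)), whose expectation is at most 1. -/
theorem entropy_submodular [Fintype A] [Fintype B] [Fintype C] (hq : ∀ ω, 0 ≤ q ω)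
    (X : Ω → A) (Y : Ω → B) (Z : Ω → C) :
    entropy q (fun ω => (X ω, Y ω, Z ω)) + entropy q Z ≤
      entropy q (fun ω => (X ω, Z ω)) + entropy q (fun ω => (Y ω, Z ω)) := by
  set r := lawOf q (fun ω => (X ω, Y ω, Z ω)) with hr
  set rx := lawOf q (fun ω => (X ω, Z ω)) with hrx
  set ry := lawOf q (fun ω => (Y ω, Z ω)) with hry
  set rz := lawOf q Z with hrz
  have hr0 : ∀ a, 0 ≤ r a := lawOf_nonneg hq _
  have hrx0 : ∀ a, 0 ≤ rx a := lawOf_nonneg hq _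
  have hry0 : ∀ a, 0 ≤ ry a := lawOf_nonneg hq _
  have hrz0 : ∀ a, 0 ≤ rz a := lawOf_nonneg hq _
  have key : ∑ ω, q ω * (rx (X ω, Z ω) * ry (Y ω, Z ω) / (r (X ω, Y ω, Z ω) * rz (Z ω))) ≤
      ∑ ω, q ω := by
    rw [← sum_lawOf_mul (fun ω => (X ω, Y ω, Z ω))
      (fun w => rx (w.1, w.2.2) * ry w.2 / (r w * rz w.2.2))]
    calc ∑ w, r w * (rx (w.1, w.2.2) * ry w.2 / (r w * rz w.2.2))
        ≤ ∑ w : A × B × C, rx (w.1, w.2.2) * ry w.2 / rz w.2.2 := by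
          refine Finset.sum_le_sum fun w _ => ?_
          rcases (hr0 w).eq_or_lt with h0 | h0
          · rw [← h0]
            simpa using div_nonneg (mul_nonneg (hrx0 _) (hry0 _)) (hrz0 _)
          · rw [mul_div_assoc', mul_div_mul_left _ _ h0.ne']
      _ = ∑ z, (∑ x, rx (x, z)) * (∑ y, ry (y, z)) / rz z := by
          simp_rw [Fintype.sum_prod_type, Finset.sum_mul_sum, Finset.sum_div]
          rw [Finset.sum_comm]
          simp_rw [Finset.sum_comm (s := (Finset.univ : Finset A)) (t := (Finset.univ : Finset C))]
          rw [Finset.sum_comm]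
          refine Finset.sum_congr rfl fun z _ => Finset.sum_comm
      _ = ∑ z, rz z := by
          refine Finset.sum_congr rfl fun z _ => ?_
          -- The identity a * a / a = a also covers values of `Z` of probability zero.
          rw [hrx, hry, sum_lawOf_prod_left, sum_lawOf_prod_left, ← hrz, mul_self_div_self]
      _ = ∑ ω, q ω := sum_lawOf Z
  have main : ∀ ω, q ω * (1 - rx (X ω, Z ω) * ry (Y ω, Z ω) / (r (X ω, Y ω, Z ω) * rz (Z ω))) ≤
      q ω * (Real.log (r (X ω, Y ω, Z ω)) + Real.log (rz (Z ω)) - Real.log (rx (X ω, Z ω)) -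
        Real.log (ry (Y ω, Z ω))) := by
    intro ω
    rcases (hq ω).eq_or_lt with h0 | h0
    · simp [← h0]
    refine mul_le_mul_of_nonneg_left ?_ h0.le
    have h1 : 0 < r (X ω, Y ω, Z ω) := lawOf_pos hq (fun ω => (X ω, Y ω, Z ω)) h0
    have h2 : 0 < rz (Z ω) := lawOf_pos hq Z h0
    have h3 : 0 < rx (X ω, Z ω) := lawOf_pos hq (fun ω => (X ω, Z ω)) h0
    have h4 : 0 < ry (Y ω, Z ω) := lawOf_pos hq (fun ω => (Y ω, Z ω)) h0
    have h5 := Real.log_le_sub_one_of_pos (div_pos (mul_pos h3 h4) (mul_pos h1 h2))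
    rw [Real.log_div (mul_pos h3 h4).ne' (mul_pos h1 h2).ne', Real.log_mul h3.ne' h4.ne',
      Real.log_mul h1.ne' h2.ne'] at h5
    linarith
  have hsum := Finset.sum_le_sum fun ω (_ : ω ∈ Finset.univ) => main ω
  simp only [mul_sub, mul_add, mul_one, Finset.sum_sub_distrib, Finset.sum_add_distrib] at hsum
  unfold entropy
  linarith

theorem entropy_prod_le [Fintype A] [Fintype B] (hq : q ∈ stdSimplex ℝ Ω)
    (X : Ω → A) (Y : Ω → B) :
    entropy q (fun ω => (X ω, Y ω)) ≤ entropy q X + entropy q Y := by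
  have h := entropy_submodular hq.1 X Y fun _ => ()
  have h0 : entropy q (fun _ => ()) = 0 := by
    simp [entropy, lawOf_eq_sum_ite, hq.2]
  rw [h0, entropy_eq_of_iff hq.1 (W := fun ω => (X ω, Y ω, ())) (Z := fun ω => (X ω, Y ω))
    (by simp), entropy_eq_of_iff hq.1 (W := fun ω => (X ω, ())) (Z := X) (by simp),
    entropy_eq_of_iff hq.1 (W := fun ω => (Y ω, ())) (Z := Y) (by simp)] at h
  linarith

theorem entropy_le_log_card [Fintype A] (hq : q ∈ stdSimplex ℝ Ω) (Z : Ω → A) :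
    entropy q Z ≤ Real.log (Fintype.card A) := by
  have hne : Nonempty A := by
    by_contra h
    rw [not_nonempty_iff] at h
    have := Function.isEmpty Z
    simpa using hq.2
  have hc : (0 : ℝ) < Fintype.card A := by exact_mod_cast Fintype.card_pos
  have hr := lawOf_mem_stdSimplex hq Z
  have hterm : ∀ a, Real.negMulLog (lawOf q Z a) ≤
      (Fintype.card A : ℝ)⁻¹ - lawOf q Z a + lawOf q Z a * Real.log (Fintype.card A) := by
    intro a
    rcases (hr.1 a).eq_or_lt with h0 | h0
    · rw [← h0]
      simp
    -- Compare with the uniform law: log t ≤ t - 1 at t = 1 / (p(a) |A|), then multiply by p(a).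
    have h1 := Real.log_le_sub_one_of_pos (inv_pos.2 (mul_pos h0 hc))
    rw [Real.log_inv, Real.log_mul h0.ne' hc.ne'] at h1
    have h2 := mul_le_mul_of_nonneg_left h1 h0.le
    have h3 : lawOf q Z a * ((lawOf q Z a * Fintype.card A)⁻¹ - 1) =
        (Fintype.card A : ℝ)⁻¹ - lawOf q Z a := by
      rw [mul_sub, mul_inv, mul_inv_cancel_left₀ h0.ne', mul_one]
    rw [h3] at h2
    rw [Real.negMulLog]
    linarith
  rw [entropy_eq_sum_negMulLog]
  refine (Finset.sum_le_sum fun a _ => hterm a).trans_eq ?_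
  rw [Finset.sum_add_distrib, Finset.sum_sub_distrib, ← Finset.sum_mul, hr.2]
  simp [hc.ne']

/-- Subadditivity of conditional entropy: peel off the first coordinate by submodularity and induct.
-/
theorem entropy_pi_le [Fintype A] [Fintype B] (hq : ∀ ω, 0 ≤ q ω) (Y : Ω → B) :
    ∀ (n : ℕ) (X : Fin n → Ω → A),
      entropy q (fun ω => ((fun i => X i ω), Y ω)) - entropy q Y ≤
        ∑ i, (entropy q (fun ω => (X i ω, Y ω)) - entropy q Y)
  | 0, X => by
    rw [entropy_eq_of_iff hq (Z := Y) (by simp [funext_iff])]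
    simp
  | n + 1, X => by
    have ih := entropy_pi_le hq Y n fun i => X i.succ
    have h := entropy_submodular hq (X 0) (fun ω i => X (Fin.succ i) ω) Y
    rw [entropy_eq_of_iff hq (W := fun ω => (X 0 ω, (fun i : Fin n => X i.succ ω), Y ω))
      (Z := fun ω => ((fun i => X i ω), Y ω))
      (by simp [funext_iff, Fin.forall_fin_succ, and_assoc])] at h
    rw [Fin.sum_univ_succ]
    linarith

/-- The conditional mutual information `I(V; L | K)` expressed through entropies. -/
theorem condMutualInfo_lawOf {M L K : Type*} [Fintype M] [Fintype L] [Fintype K]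
    (hq : ∀ ω, 0 ≤ q ω) (V : Ω → M) (X : Ω → L) (Y : Ω → K) :
    condMutualInfo (lawOf q fun ω => (V ω, X ω, Y ω)) * Real.log 2 =
      entropy q (fun ω => (V ω, Y ω)) + entropy q (fun ω => (X ω, Y ω)) -
        entropy q (fun ω => (V ω, X ω, Y ω)) - entropy q Y := by
  unfold condMutualInfo
  simp_rw [lawOf_lawOf]
  have h := sum_lawOf_mul (q := q) (fun ω => (V ω, X ω, Y ω)) fun w =>
    Real.logb 2 ((lawOf q (fun ω => (V ω, X ω, Y ω)) w * lawOf q Y w.2.2) /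
      (lawOf q (fun ω => (V ω, Y ω)) (w.1, w.2.2) * lawOf q (fun ω => (X ω, Y ω)) w.2))
  simp only [Fintype.sum_prod_type] at h
  rw [h, Finset.sum_mul]
  unfold entropy
  rw [sub_neg_eq_add, sub_neg_eq_add, ← neg_add, ← Finset.sum_add_distrib,
    ← Finset.sum_neg_distrib, ← Finset.sum_add_distrib, ← Finset.sum_add_distrib]
  refine Finset.sum_congr rfl fun ω _ => ?_
  rcases (hq ω).eq_or_lt with h0 | h0
  · simp [← h0]
  have h1 := lawOf_pos hq (fun ω => (V ω, X ω, Y ω)) h0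
  have h2 := lawOf_pos hq Y h0
  have h3 := lawOf_pos hq (fun ω => (V ω, Y ω)) h0
  have h4 := lawOf_pos hq (fun ω => (X ω, Y ω)) h0
  rw [mul_assoc, Real.logb, div_mul_cancel₀ _ (Real.log_pos one_lt_two).ne',
    Real.log_div (mul_pos h1 h2).ne' (mul_pos h3 h4).ne', Real.log_mul h1.ne' h2.ne',
    Real.log_mul h3.ne' h4.ne']
  ring

/-- Supplies the lower bound that makes the infimum in `condGraphEntropy` meaningful. -/
theorem condMutualInfo_nonneg {M L K : Type*} [Fintype M] [Fintype L] [Fintype K]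
    {r : M × L × K → ℝ} (hr : ∀ w, 0 ≤ r w) : 0 ≤ condMutualInfo r := by
  have h := condMutualInfo_lawOf hr (fun w => w.1) (fun w => w.2.1) (fun w => w.2.2)
  have h' := entropy_submodular hr (fun w => w.1) (fun w => w.2.1) (fun w => w.2.2)
  have hid : lawOf r (fun w => (w.1, w.2.1, w.2.2)) = r := funext lawOf_id
  rw [hid] at h
  refine nonneg_of_mul_nonneg_left (b := Real.log 2) ?_ (Real.log_pos one_lt_two)
  linarith

end Entropy

/-! ### Independent copies -/

section ProductLaw

variable {Ω A B : Type*} [Fintype Ω] {p : Ω → ℝ}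

/-- The law of `n` independent outcomes, each with law `p`. -/
def iidLaw (p : Ω → ℝ) (n : ℕ) (x : Fin n → Ω) : ℝ := ∏ i, p (x i)

theorem iidLaw_mem_stdSimplex (hp : p ∈ stdSimplex ℝ Ω) (n : ℕ) :
    iidLaw p n ∈ stdSimplex ℝ (Fin n → Ω) := by
  refine ⟨fun x => Finset.prod_nonneg fun i _ => hp.1 _, ?_⟩
  unfold iidLaw
  rw [← Fintype.prod_sum]
  simp [hp.2]

theorem lawOf_iidLaw (n : ℕ) (W : Ω → A) (a : Fin n → A) :
    lawOf (iidLaw p n) (fun x i => W (x i)) a = iidLaw (lawOf p W) n a := by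
  classical
  unfold iidLaw
  simp_rw [lawOf_eq_sum_ite, Fintype.prod_sum, Finset.prod_ite_zero, funext_iff]
  simp

theorem sum_negMulLog_iidLaw (hp : p ∈ stdSimplex ℝ Ω) :
    ∀ n : ℕ, ∑ x, Real.negMulLog (iidLaw p n x) = n * ∑ a, Real.negMulLog (p a)
  | 0 => by simp [iidLaw]
  | n + 1 => by
    rw [← (Fin.consEquiv fun _ => Ω).sum_comp, Fintype.sum_prod_type]
    have h : ∀ (a : Ω) (x : Fin n → Ω),
        iidLaw p (n + 1) (Fin.consEquiv (fun _ => Ω) (a, x)) = p a * iidLaw p n x := by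
      intro a x
      simp [iidLaw, Fin.consEquiv, Fin.prod_univ_succ]
    simp_rw [h, Real.negMulLog_mul, Finset.sum_add_distrib, ← Finset.mul_sum, ← Finset.sum_mul]
    rw [sum_negMulLog_iidLaw hp n, (iidLaw_mem_stdSimplex hp n).2, hp.2]
    push_cast
    simp only [one_mul]
    ring

theorem entropy_iidLaw [Fintype A] (hp : p ∈ stdSimplex ℝ Ω) (n : ℕ) (W : Ω → A) :
    entropy (iidLaw p n) (fun x i => W (x i)) = n * entropy p W := by
  rw [entropy_eq_sum_negMulLog, entropy_eq_sum_negMulLog,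
    ← sum_negMulLog_iidLaw (lawOf_mem_stdSimplex hp W)]
  simp_rw [lawOf_iidLaw]

theorem lawOf_iidLaw_apply (hp : p ∈ stdSimplex ℝ Ω) {n : ℕ} (i : Fin n) (W : Ω → A) (a : A) :
    lawOf (iidLaw p n) (fun x => W (x i)) a = lawOf p W a := by
  classical
  obtain ⟨n, rfl⟩ : ∃ m, n = m + 1 := ⟨n - 1, by have := i.2; omega⟩
  rw [lawOf_equiv (Fin.insertNthEquiv (fun _ => Ω) i), lawOf_eq_sum_ite, Fintype.sum_prod_type,
    lawOf_eq_sum_ite]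
  refine Finset.sum_congr rfl fun w _ => ?_
  have h := (iidLaw_mem_stdSimplex hp n).2
  unfold iidLaw at h
  by_cases hw : W w = a <;>
    simp [hw, iidLaw, Fin.insertNthEquiv, Fin.prod_univ_succAbove _ i, ← Finset.mul_sum, h]

/-- If `U` depends on the `i`-th outcome only through `X (x i)`, then `U - X (x i) - Y (x i)` is a
Markov chain. -/
theorem isMarkovChain_iidLaw {L K M : Type*} [Fintype L] [Fintype K] [Fintype M]
    (hp : p ∈ stdSimplex ℝ Ω) {n : ℕ} (i : Fin n) (X : Ω → L) (Y : Ω → K)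
    (U : (Fin n → Ω) → M)
    (hU : ∀ x y, (∀ j, j ≠ i → x j = y j) → X (x i) = X (y i) → U x = U y) :
    IsMarkovChain (lawOf (iidLaw p n) fun x => (U x, X (x i), Y (x i))) := by
  classical
  obtain ⟨n, rfl⟩ : ∃ m, n = m + 1 := ⟨n - 1, by have := i.2; omega⟩
  intro u l k
  simp only [lawOf_lawOf]
  rw [lawOf_iidLaw_apply hp i X, lawOf_iidLaw_apply hp i fun w => (X w, Y w)]
  by_cases hl : ∃ w, X w = l
  swap
  · push Not at hl
    rw [lawOf_eq_zero (Z := X) hl, lawOf_eq_zero (Z := fun w => (X w, Y w)) (by simp [hl])]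
    simp
  obtain ⟨w₀, hw₀⟩ := hl
  set e := Fin.insertNthEquiv (fun _ => Ω) i
  -- The probability of U = u given X_i = l: by `hU` it does not depend on which outcome with X = l
  -- sits in position i. Both joint laws below factor through it.
  set c := ∑ y : Fin n → Ω, if U (e (w₀, y)) = u then iidLaw p n y else 0 with hc
  have hval : ∀ w y, e (w, y) i = w := fun w y => by simp [e, Fin.insertNthEquiv]
  have hUe : ∀ w y, X w = l → U (e (w, y)) = U (e (w₀, y)) := by
    intro w y hw
    refine hU _ _ (fun j hj => ?_) (by rw [hval, hval, hw, hw₀])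
    obtain ⟨j, rfl⟩ := Fin.exists_succAbove_eq hj
    simp [e, Fin.insertNthEquiv]
  have hfac : ∀ w y, iidLaw p (n + 1) (e (w, y)) = p w * iidLaw p n y := fun w y => by
    simp [e, iidLaw, Fin.insertNthEquiv, Fin.prod_univ_succAbove _ i]
  have h1 : lawOf (iidLaw p (n + 1)) (fun x => (U x, X (x i), Y (x i))) (u, l, k) =
      lawOf p (fun w => (X w, Y w)) (l, k) * c := by
    rw [lawOf_equiv e, lawOf_eq_sum_ite, Fintype.sum_prod_type, lawOf_eq_sum_ite, Finset.sum_mul]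
    refine Finset.sum_congr rfl fun w _ => ?_
    by_cases hw : X w = l ∧ Y w = k
    · simp [hval, hfac, hw, hUe, hc, Finset.mul_sum]
    · have h0 : ¬(X w, Y w) = (l, k) := by simpa using hw
      simp only [hval, Prod.mk.injEq, and_false, h0, if_false, Finset.sum_const_zero, zero_mul]
  have h2 : lawOf (iidLaw p (n + 1)) (fun x => (U x, X (x i))) (u, l) = lawOf p X l * c := by
    rw [lawOf_equiv e, lawOf_eq_sum_ite, Fintype.sum_prod_type, lawOf_eq_sum_ite, Finset.sum_mul]
    refine Finset.sum_congr rfl fun w _ => ?_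
    by_cases hw : X w = l
    · simp [hval, hfac, hw, hUe, hc, Finset.mul_sum]
    · simp only [hval, Prod.mk.injEq, hw, and_false, if_false, Finset.sum_const_zero, zero_mul]
  rw [h1, h2]
  ring

end ProductLaw

/-! ### The single-letter bound with small error -/

section SingleLetter

variable {Ω L K S F M : Type*} [Fintype Ω] [Fintype L] [Fintype K] [Fintype S] [Fintype M]
  {q : Ω → ℝ} {p : L × K × S → ℝ} {f : S → F}

/-- Allows any finite index type for the independent sets; `W` need not be injective, since a
multiset is allowed. -/
theorem condGraphEntropy_le (hq : q ∈ stdSimplex ℝ Ω) (V : Ω → M) (X : Ω → L) (Y : Ω → K)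
    (W : M → Set L) (hW : ∀ t, (condCharGraph p f).IsIndepSet (W t))
    (hlaw : lawOf q (fun ω => (X ω, Y ω)) = lawOf p fun w => (w.1, w.2.1))
    (hmarkov : IsMarkovChain (lawOf q fun ω => (V ω, X ω, Y ω)))
    (hmem : ∀ ω, 0 < q ω → X ω ∈ W (V ω)) :
    condGraphEntropy p f * Real.log 2 ≤
      entropy q (fun ω => (V ω, Y ω)) + entropy q (fun ω => (X ω, Y ω)) -
        entropy q (fun ω => (V ω, X ω, Y ω)) - entropy q Y := by
  set e := Fintype.equivFin M
  have hI := condMutualInfo_lawOf hq.1 (fun ω => e (V ω)) X Y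
  rw [entropy_eq_of_iff hq.1 (W := fun ω => (e (V ω), Y ω)) (Z := fun ω => (V ω, Y ω)) (by simp),
    entropy_eq_of_iff hq.1 (W := fun ω => (e (V ω), X ω, Y ω)) (Z := fun ω => (V ω, X ω, Y ω))
      (by simp)] at hI
  rw [← hI]
  refine mul_le_mul_of_nonneg_right (csInf_le ⟨0, ?_⟩ ?_) (Real.log_pos one_lt_two).le
  · rintro _ ⟨m, W', r, -, hr, -, -, -, rfl⟩
    exact condMutualInfo_nonneg hr.1
  · refine ⟨_, fun t => W (e.symm t), lawOf q fun ω => (e (V ω), X ω, Y ω), fun t => hW _,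
      lawOf_mem_stdSimplex hq _, ?_, ?_, ?_, rfl⟩
    · rw [← hlaw]
      funext w
      rw [lawOf_lawOf]
    · intro t l k
      have h := hmarkov (e.symm t) l k
      simp only [lawOf_lawOf] at h ⊢
      rw [lawOf_congr (W := fun ω => (V ω, X ω, Y ω)) (b := (e.symm t, l, k))
        (by simp [Equiv.eq_symm_apply]),
        lawOf_congr (Z := fun ω => (e (V ω), X ω)) (W := fun ω => (V ω, X ω)) (b := (e.symm t, l))
        (by simp [Equiv.eq_symm_apply])]
      exact h
    · intro t l k h
      obtain ⟨ω, hω, hpos⟩ := exists_of_lawOf_pos hq.1 h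
      simp only [Prod.mk.injEq] at hω
      obtain ⟨rfl, rfl, rfl⟩ := hω
      simpa using hmem ω hpos

theorem IsMarkovChain.prodMk {N : Type*} [Fintype N] {U : Ω → M} {X : Ω → L} {Y : Ω → K}
    (h : IsMarkovChain (lawOf q fun ω => (U ω, X ω, Y ω))) (g : M → L → N) :
    IsMarkovChain (lawOf q fun ω => ((U ω, g (U ω) (X ω)), X ω, Y ω)) := by
  rintro ⟨u, t⟩ l k
  have h := h u l k
  simp only [lawOf_lawOf] at h ⊢
  by_cases ht : g u l = t
  · rw [lawOf_congr (W := fun ω => (U ω, X ω, Y ω)) (b := (u, l, k)),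
      lawOf_congr (Z := fun ω => ((U ω, g (U ω) (X ω)), X ω)) (W := fun ω => (U ω, X ω))
        (b := (u, l))]
    · exact h
    · intro ω
      simp only [Prod.mk.injEq]
      constructor
      · tauto
      · rintro ⟨rfl, rfl⟩
        simp [ht]
    · intro ω
      simp only [Prod.mk.injEq]
      constructor
      · tauto
      · rintro ⟨rfl, rfl, rfl⟩
        simp [ht]
  · rw [lawOf_eq_zero, lawOf_eq_zero (Z := fun ω => ((U ω, g (U ω) (X ω)), X ω)), zero_mul,
      zero_mul]
    · rintro ω hω
      simp only [Prod.mk.injEq] at hω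
      obtain ⟨⟨rfl, h1⟩, rfl⟩ := hω
      exact ht h1
    · rintro ω hω
      simp only [Prod.mk.injEq] at hω
      obtain ⟨⟨rfl, h1⟩, rfl, -⟩ := hω
      exact ht h1

/-- The realizations of `L` for which the estimate `g` of `h` is never wrong. -/
def errorFreeSet (r : L × K → ℝ) (h : L → K → F) (g : K → F) : Set L :=
  {l | ∀ k, 0 < r (l, k) → g k = h l k}

/-- An edge would provide one k, possible with both endpoints, at which `g k` equals two different
values of the function. -/
theorem isIndepSet_errorFreeSet (hp : ∀ w, 0 ≤ p w) {h : L → K → F}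
    (hf : ∀ l k s, 0 < p (l, k, s) → f s = h l k) (g : K → F) :
    (condCharGraph p f).IsIndepSet
      (errorFreeSet (lawOf p fun w => (w.1, w.2.1)) h g) := by
  rintro l₁ h₁ l₂ h₂ - ⟨-, k, s₁, s₂, hpos, hne⟩
  have hp₁ : 0 < p (l₁, k, s₁) := (hp _).lt_of_ne fun h0 => by simp [← h0] at hpos
  have hp₂ : 0 < p (l₂, k, s₂) := (hp _).lt_of_ne fun h0 => by simp [← h0] at hpos
  apply hne
  rw [hf _ _ _ hp₁, hf _ _ _ hp₂, ← h₁ k (lawOf_pos hp (fun w => (w.1, w.2.1)) hp₁),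
    ← h₂ k (lawOf_pos hp (fun w => (w.1, w.2.1)) hp₂)]

-- A bad pair (u, l) has a witness k at which the estimate is wrong. By the Markov property and p(l)
-- ≤ 1, p(u, l, k) ≥ p(u, l) p(l, k) ≥ δ p(u, l), so a fraction δ of the bad mass already produces
-- errors.
open Classical in
theorem mul_prob_notMem_errorFreeSet_le (hq : q ∈ stdSimplex ℝ Ω) (U : Ω → M) (X : Ω → L)
    (Y : Ω → K) (hmarkov : IsMarkovChain (lawOf q fun ω => (U ω, X ω, Y ω)))
    {r : L × K → ℝ} (hr : lawOf q (fun ω => (X ω, Y ω)) = r)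
    {δ : ℝ} (hδ : ∀ w, 0 < r w → δ ≤ r w) (h : L → K → F) (g : M → K → F) :
    δ * ∑ ω with X ω ∉ errorFreeSet r h (g (U ω)), q ω ≤
      ∑ ω with g (U ω) (Y ω) ≠ h (X ω) (Y ω), q ω := by
  have hbad : ∀ (u : M) (l : L), ∃ k, l ∉ errorFreeSet r h (g u) → 0 < r (l, k) ∧ g u k ≠ h l k := by
    intro u l
    by_cases hl : l ∈ errorFreeSet r h (g u)
    · obtain ⟨ω⟩ : Nonempty Ω := by
        by_contra hne
        rw [not_nonempty_iff] at hne
        simpa using hq.2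
      exact ⟨Y ω, fun hn => absurd hl hn⟩
    · simp only [errorFreeSet, Set.mem_ofPred_eq, not_forall] at hl
      obtain ⟨k, hk, hne⟩ := hl
      exact ⟨k, fun _ => ⟨hk, hne⟩⟩
  choose κ hκ using hbad
  set b : M × L → ℝ := fun w => if w.2 ∉ errorFreeSet r h (g w.1) then 1 else 0 with hb
  have hleft : ∑ ω with X ω ∉ errorFreeSet r h (g (U ω)), q ω =
      ∑ w, lawOf q (fun ω => (U ω, X ω)) w * b w := by
    rw [sum_lawOf_mul, Finset.sum_filter]
    simp [hb]
  have hterm : ∀ w : M × L, δ * (lawOf q (fun ω => (U ω, X ω)) w * b w) ≤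
      lawOf q (fun ω => (U ω, X ω, Y ω)) (w.1, w.2, κ w.1 w.2) * b w := by
    rintro ⟨u, l⟩
    by_cases hl : l ∈ errorFreeSet r h (g u)
    · simp [hb, hl]
    obtain ⟨hpos, -⟩ := hκ u l hl
    have hm := hmarkov u l (κ u l)
    simp only [lawOf_lawOf] at hm
    rw [hr] at hm
    have h1 : lawOf q X l ≤ 1 := by
      rw [← hq.2]
      unfold lawOf
      exact Finset.sum_le_sum_of_subset_of_nonneg (Finset.subset_univ _) fun _ _ _ => hq.1 _
    have h2 := mul_le_mul_of_nonneg_left (hδ _ hpos) (lawOf_nonneg hq.1 (fun ω => (U ω, X ω)) (u, l))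
    have h3 := mul_le_of_le_one_right
      (lawOf_nonneg hq.1 (fun ω => (U ω, X ω, Y ω)) (u, l, κ u l)) h1
    simp only [hb, hl, not_false_eq_true, if_true, mul_one]
    linarith
  have hpush : ∑ w : M × L, lawOf q (fun ω => (U ω, X ω, Y ω)) (w.1, w.2, κ w.1 w.2) * b w =
      ∑ ω, if Y ω = κ (U ω) (X ω) then q ω * b (U ω, X ω) else 0 := by
    simp_rw [lawOf_eq_sum_ite, Finset.sum_mul]
    rw [Finset.sum_comm]
    refine Finset.sum_congr rfl fun ω _ => ?_
    rw [Finset.sum_eq_single (U ω, X ω)]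
    · simp [ite_mul]
    · rintro ⟨u, l⟩ - hne
      rw [if_neg, zero_mul]
      rintro heq
      simp only [Prod.mk.injEq] at heq
      exact hne (by rw [heq.1, heq.2.1])
    · simp
  rw [hleft, Finset.mul_sum]
  refine (Finset.sum_le_sum fun w _ => hterm w).trans ?_
  rw [hpush, Finset.sum_filter]
  refine Finset.sum_le_sum fun ω _ => ?_
  by_cases hy : Y ω = κ (U ω) (X ω)
  · by_cases hl : X ω ∈ errorFreeSet r h (g (U ω))
    · simp only [hb, hl, not_true_eq_false, if_false, mul_zero, ite_self]
      split_ifs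
      exacts [hq.1 ω, le_rfl]
    · have := (hκ _ _ hl).2
      rw [← hy] at this
      rw [if_pos this, if_pos hy]
      simp [hb, hl]
  · rw [if_neg hy]
    split_ifs
    exacts [hq.1 ω, le_rfl]

/-- A random variable that takes a fixed value with probability close to one has small entropy. -/
theorem exists_entropy_option_le (L : Type*) [Fintype L] {η : ℝ} (hη : 0 < η) :
    ∃ ε > 0, ∀ {Ω : Type*} [Fintype Ω] (q : Ω → ℝ) (_ : q ∈ stdSimplex ℝ Ω) (Z : Ω → Option L),
      1 - lawOf q Z none ≤ ε → entropy q Z ≤ η := by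
  -- The number of terms of the entropy sum. Each is made at most η / c, since `negMulLog` is
  -- continuous and vanishes at 0 and 1; so ε is uniform in the probability space.
  set c : ℝ := Fintype.card L + 1 with hc
  have hc0 : 0 < c := by positivity
  have h0 : ∀ᶠ t in nhds (0 : ℝ), Real.negMulLog t < η / c :=
    Real.continuous_negMulLog.continuousAt.eventually_lt continuousAt_const
      (by simpa using div_pos hη hc0)
  have h1 : ∀ᶠ t in nhds (0 : ℝ), Real.negMulLog (1 - t) < η / c :=
    ContinuousAt.eventually_lt (f := fun t => Real.negMulLog (1 - t)) (by fun_prop)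
      continuousAt_const (by simpa using div_pos hη hc0)
  obtain ⟨ε, hε, hball⟩ := Metric.eventually_nhds_iff.1 (h0.and h1)
  refine ⟨ε / 2, half_pos hε, fun q hq Z hZ => ?_⟩
  have hr := lawOf_mem_stdSimplex hq Z
  have hsum := hr.2
  rw [Fintype.sum_option] at hsum
  have hsome : ∀ l, lawOf q Z (some l) ≤ ε / 2 := fun l => by
    have := Finset.single_le_sum (f := fun l => lawOf q Z (some l)) (fun l _ => hr.1 _)
      (Finset.mem_univ l)
    linarith [hsum, hr.1 none]
  have hs0 : 0 ≤ ∑ l, lawOf q Z (some l) := Finset.sum_nonneg fun l _ => hr.1 _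
  rw [entropy_eq_sum_negMulLog, Fintype.sum_option]
  have hn : Real.negMulLog (lawOf q Z none) ≤ η / c := by
    have := (@hball (1 - lawOf q Z none) (by
      rw [Real.dist_eq, sub_zero, abs_of_nonneg (by linarith)]; linarith)).2.le
    simpa using this
  have hl : ∀ l ∈ Finset.univ, Real.negMulLog (lawOf q Z (some l)) ≤ η / c := fun l _ =>
    (@hball (lawOf q Z (some l)) (by
      rw [Real.dist_eq, sub_zero, abs_of_nonneg (hr.1 _)]; linarith [hsome l])).1.le
  have := Finset.sum_le_card_nsmul _ _ _ hl
  rw [nsmul_eq_mul, Finset.card_univ] at this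
  have hηc : η = Fintype.card L * (η / c) + η / c := by
    field_simp
    rw [hc]
  linarith

/-- If `f` can be computed from `(U, Y)` with small error probability, where `U - X - Y` is a
Markov chain, then `I(U; X | Y)` is almost as large as the conditional graph entropy. -/
theorem exists_condGraphEntropy_le_add (hp : ∀ w, 0 ≤ p w) {h : L → K → F}
    (hf : ∀ l k s, 0 < p (l, k, s) → f s = h l k) {η : ℝ} (hη : 0 < η) :
    ∃ ε > 0, ∀ {Ω M : Type*} [Fintype Ω] [Fintype M] (q : Ω → ℝ) (_ : q ∈ stdSimplex ℝ Ω)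
      (U : Ω → M) (X : Ω → L) (Y : Ω → K) (g : M → K → F),
      lawOf q (fun ω => (X ω, Y ω)) = lawOf p (fun w => (w.1, w.2.1)) →
      IsMarkovChain (lawOf q fun ω => (U ω, X ω, Y ω)) →
      (open Classical in ∑ ω with g (U ω) (Y ω) ≠ h (X ω) (Y ω), q ω) ≤ ε →
      condGraphEntropy p f * Real.log 2 ≤
        entropy q (fun ω => (U ω, Y ω)) + entropy q (fun ω => (X ω, Y ω)) -
          entropy q (fun ω => (X ω, U ω, Y ω)) - entropy q Y + η := by
  classical
  set r := lawOf p (fun w => (w.1, w.2.1)) with hr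
  -- The least positive probability of a pair; it exists because the alphabets are finite.
  obtain ⟨δ, hδ, hδr⟩ : ∃ δ > 0, ∀ w, 0 < r w → δ ≤ r w := by
    obtain hE | hE := (Finset.univ.filter fun w => 0 < r w).eq_empty_or_nonempty
    · exact ⟨1, one_pos, fun w hw => absurd hw (Finset.filter_eq_empty_iff.1 hE (Finset.mem_univ w))⟩
    · obtain ⟨w₀, hw₀, hmin⟩ := Finset.exists_min_image _ r hE
      exact ⟨r w₀, (Finset.mem_filter.1 hw₀).2, fun w hw => hmin w (by simpa using hw)⟩
  obtain ⟨ε, hε, hsmall⟩ := exists_entropy_option_le L hη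
  refine ⟨δ * ε, mul_pos hδ hε, fun {Ω M} _ _ q hq U X Y g hlaw hmarkov herr => ?_⟩
  set G : M → Set L := fun u => errorFreeSet r h (g u) with hG
  -- `none` selects the error-free set of u, `some l` the exceptional singleton {l}.
  set t : M → L → Option L := fun u l => if l ∈ G u then none else some l with ht
  have hle := condGraphEntropy_le (p := p) (f := f) hq (fun ω => (U ω, t (U ω) (X ω))) X Y
    (fun v => v.2.elim (G v.1) fun l => {l})
    (fun v => ?_) hlaw (hmarkov.prodMk t) (fun ω _ => ?_)
  rotate_left
  · rcases v with ⟨u, _ | l⟩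
    · exact isIndepSet_errorFreeSet hp hf (g u)
    · simp
  · by_cases hx : X ω ∈ G (U ω) <;> simp [ht, hx]
  have hbad := mul_prob_notMem_errorFreeSet_le hq U X Y hmarkov hlaw hδr h g
  have hT : entropy q (fun ω => t (U ω) (X ω)) ≤ η := by
    refine hsmall q hq _ ?_
    have hsplit := Finset.sum_filter_add_sum_filter_not Finset.univ (fun ω => X ω ∈ G (U ω)) q
    have hnone : lawOf q (fun ω => t (U ω) (X ω)) none = ∑ ω with X ω ∈ G (U ω), q ω := by
      unfold lawOf
      congr 1
      ext ω
      simp [ht]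
    rw [hnone, ← hq.2, ← hsplit, add_sub_cancel_left]
    exact le_of_mul_le_mul_left (hbad.trans herr) hδ
  have h1 : entropy q (fun ω => ((U ω, t (U ω) (X ω)), Y ω)) ≤
      entropy q (fun ω => (U ω, Y ω)) + entropy q (fun ω => t (U ω) (X ω)) := by
    refine le_trans (le_of_eq ?_) (entropy_prod_le hq (fun ω => (U ω, Y ω)) fun ω => t (U ω) (X ω))
    exact entropy_eq_of_iff hq.1 (by simp; tauto)
  have h2 : entropy q (fun ω => (X ω, U ω, Y ω)) ≤
      entropy q (fun ω => ((U ω, t (U ω) (X ω)), X ω, Y ω)) :=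
    entropy_le_of_factors hq.1 (by simp; tauto)
  linarith

end SingleLetter

/-! ### From blocks to single letters -/

section BlockConverse

/-- The block converse: if the block of the values of `f` can be computed with small error
probability from the block of `Y` and a function of the block of `X` with values in `M`, then the
conditional graph entropy is at most slightly larger than `(log₂ |M|) / n`. -/
theorem exists_mul_condGraphEntropy_le {Ω L K S F : Type*} [Fintype Ω] [Fintype L] [Fintype K]
    [Fintype S] {q : Ω → ℝ} {p : L × K × S → ℝ} {f : S → F} (hq : q ∈ stdSimplex ℝ Ω)
    (hp : ∀ w, 0 ≤ p w) (X : Ω → L) (Y : Ω → K)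
    (hlaw : lawOf q (fun ω => (X ω, Y ω)) = lawOf p fun w => (w.1, w.2.1)) {h : L → K → F}
    (hf : ∀ l k s, 0 < p (l, k, s) → f s = h l k) {η : ℝ} (hη : 0 < η) :
    ∃ ε > 0, ∀ (n : ℕ) {M : Type*} [Fintype M] (m : (Fin n → Ω) → M)
      (out : (Fin n → Ω) → Fin n → F),
      (∀ x y, (∀ j, X (x j) = X (y j)) → m x = m y) →
      (∀ x y, m x = m y → (∀ j, Y (x j) = Y (y j)) → out x = out y) →
      (open Classical in
        ∑ x : Fin n → Ω with out x ≠ (fun i => h (X (x i)) (Y (x i))), iidLaw q n x) ≤ ε →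
      n * (condGraphEntropy p f * Real.log 2) ≤ Real.log (Fintype.card M) + n * η := by
  classical
  obtain ⟨ε, hε, hsingle⟩ := exists_condGraphEntropy_le_add hp hf hη
  refine ⟨ε, hε, fun n M _ m out hm hout herr => ?_⟩
  obtain ⟨ω₀⟩ : Nonempty Ω := by
    by_contra hne
    rw [not_nonempty_iff] at hne
    simpa using hq.2
  have hqn := iidLaw_mem_stdSimplex hq n
  set Q := iidLaw q n with hQ
  have hbound : ∀ i : Fin n, condGraphEntropy p f * Real.log 2 ≤
      entropy q (fun ω => (X ω, Y ω)) - entropy q Y -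
        (entropy Q (fun x => (X (x i), m x, fun j => Y (x j))) -
          entropy Q (fun x => (m x, fun j => Y (x j)))) + η := by
    intro i
    set U : (Fin n → Ω) → M × ({j // j ≠ i} → K) := fun x => (m x, fun j => Y (x j.1)) with hU
    have hiff : ∀ x y, (U x = U y ∧ Y (x i) = Y (y i)) ↔ (m x = m y ∧ ∀ j, Y (x j) = Y (y j)) := by
      intro x y
      simp only [hU, Prod.mk.injEq, funext_iff, Subtype.forall]
      constructor
      · rintro ⟨⟨h1, h2⟩, h3⟩
        refine ⟨h1, fun j => ?_⟩
        by_cases hj : j = i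
        · rw [hj, h3]
        · exact h2 j hj
      · rintro ⟨h1, h2⟩
        exact ⟨⟨h1, fun j _ => h2 j⟩, h2 i⟩
    -- The i-th output as a function of (U, Y_i); off the range of this pair its value is an
    -- irrelevant default.
    set g := Function.extend (fun x => (U x, Y (x i))) (fun x => out x i)
      fun _ => h (X ω₀) (Y ω₀) with hg
    have hgout : ∀ x, g (U x, Y (x i)) = out x i := by
      intro x
      refine Function.FactorsThrough.extend_apply (f := fun x => (U x, Y (x i))) ?_ _ x
      intro x y hxy
      obtain ⟨h1, h2⟩ := (hiff x y).1 (by simpa using hxy)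
      simp only [hout x y h1 h2]
    have h1 := hsingle Q hqn U (fun x => X (x i)) (fun x => Y (x i)) (fun u k => g (u, k))
      (by
        rw [← hlaw]
        funext w
        exact lawOf_iidLaw_apply hq i (fun ω => (X ω, Y ω)) w)
      (isMarkovChain_iidLaw hq i X Y U fun x y h1 h2 => by
        have hX : ∀ j, X (x j) = X (y j) := fun j => by
          by_cases hj : j = i
          · rw [hj, h2]
          · rw [h1 j hj]
        simp only [hU, Prod.mk.injEq]
        exact ⟨hm x y hX, funext fun j => by rw [h1 j j.2]⟩)
      (by
        refine le_trans (Finset.sum_le_sum_of_subset_of_nonneg ?_ fun _ _ _ => hqn.1 _) herr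
        intro x
        simp only [hgout, Finset.mem_filter, Finset.mem_univ, true_and]
        exact fun hne heq => hne (congrFun heq i))
    have e1 : entropy Q (fun x => (X (x i), Y (x i))) = entropy q (fun ω => (X ω, Y ω)) := by
      simp only [entropy_eq_sum_negMulLog]
      exact Finset.sum_congr rfl fun w _ => by
        rw [hQ, lawOf_iidLaw_apply hq i (fun ω => (X ω, Y ω)) w]
    have e2 : entropy Q (fun x => Y (x i)) = entropy q Y := by
      simp only [entropy_eq_sum_negMulLog]
      exact Finset.sum_congr rfl fun w _ => by rw [hQ, lawOf_iidLaw_apply hq i Y w]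
    have e3 : entropy Q (fun x => (U x, Y (x i))) = entropy Q (fun x => (m x, fun j => Y (x j))) :=
      entropy_eq_of_iff hqn.1 fun x y => by
        simpa [funext_iff] using (hiff x y).symm
    have e4 : entropy Q (fun x => (X (x i), U x, Y (x i))) =
        entropy Q (fun x => (X (x i), m x, fun j => Y (x j))) :=
      entropy_eq_of_iff hqn.1 fun x y => by
        have := hiff x y
        simp only [Prod.mk.injEq, funext_iff] at this ⊢
        rw [this]
    rw [e1, e2, e3, e4] at h1
    linarith
  have hsum := Finset.sum_le_sum fun i (_ : i ∈ Finset.univ) => hbound i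
  rw [Finset.sum_add_distrib, Finset.sum_sub_distrib] at hsum
  simp only [Finset.sum_const, Finset.card_univ, Fintype.card_fin, nsmul_eq_mul] at hsum
  -- The sum of H(X_i | m, Y^n) is at least H(X^n | m, Y^n), which by the next two estimates is at
  -- least n H(X | Y) - log |M|.
  have hpi := entropy_pi_le hqn.1 (fun x => (m x, fun j => Y (x j))) n fun i x => X (x i)
  have hXY : n * entropy q (fun ω => (X ω, Y ω)) ≤
      entropy Q (fun x => ((fun i => X (x i)), m x, fun j => Y (x j))) := by
    rw [← entropy_iidLaw hq n fun ω => (X ω, Y ω)]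
    exact entropy_le_of_factors hqn.1 fun x y hxy => by
      simp only [Prod.mk.injEq, funext_iff] at hxy ⊢
      exact fun j => ⟨hxy.1 j, hxy.2.2 j⟩
  have hY : entropy Q (fun x => (m x, fun j => Y (x j))) ≤
      Real.log (Fintype.card M) + n * entropy q Y := by
    rw [← entropy_iidLaw hq n Y]
    exact (entropy_prod_le hqn m fun x j => Y (x j)).trans
      (add_le_add_left (entropy_le_log_card hqn m) _)
  linarith

end BlockConverse

/-! ### Flow of information across a cut -/

namespace TreeCode

variable {V : Type*} [Finite V] {T : RootedDirectedTree V} {X : V → Type*} {F : Type*}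
  {R : T.NonRoot → ℝ} {n : ℕ}

/-- The messages sent inside a set that is closed under `Child` depend only on the sources in that
set. -/
theorem msg_congr_of_child_subset (c : TreeCode T X F R n) {S : Set V}
    (hS : ∀ u ∈ S, T.Child u ⊆ S) {x y : Fin n → ∀ u, X u}
    (hxy : ∀ i, ∀ w ∈ S, x i w = y i w) (u : T.NonRoot) (hu : u.1 ∈ S) :
    c.msg x u = c.msg y u := by
  obtain ⟨u, hne⟩ := u
  induction u using T.wellFounded_edge.induction with
  | _ u ih =>
    rw [msg, msg]
    congr 1
    · exact funext fun i => hxy i u hu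
    · funext v
      exact ih v.1.1 ⟨v.1.2, v.2⟩ v.1.2
        (hS u hu (Relation.ReflTransGen.single ⟨v.1.2, v.2⟩))

/-- The messages sent outside `S` depend only on the sources outside `S` and on the messages
leaving `S`. -/
theorem msg_congr_of_cut (c : TreeCode T X F R n) {S : Set V} {x y : Fin n → ∀ u, X u}
    (hxy : ∀ i, ∀ w ∉ S, x i w = y i w)
    (hcut : ∀ v : T.NonRoot, v.1 ∈ S → T.out v ∉ S → c.msg x v = c.msg y v)
    (u : T.NonRoot) (hu : u.1 ∉ S) : c.msg x u = c.msg y u := by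
  obtain ⟨u, hne⟩ := u
  induction u using T.wellFounded_edge.induction with
  | _ u ih =>
    rw [msg, msg]
    congr 1
    · exact funext fun i => hxy i u hu
    · funext v
      by_cases hv : v.1.1 ∈ S
      · exact hcut v.1 hv (by rw [v.2]; exact hu)
      · exact ih v.1.1 ⟨v.1.2, v.2⟩ v.1.2 hv

theorem output_congr_of_cut (c : TreeCode T X F R n) {S : Set V} (hroot : T.root ∉ S)
    {x y : Fin n → ∀ u, X u} (hxy : ∀ i, ∀ w ∉ S, x i w = y i w)
    (hcut : ∀ v : T.NonRoot, v.1 ∈ S → T.out v ∉ S → c.msg x v = c.msg y v) :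
    c.output x = c.output y := by
  unfold output
  congr 1
  · exact funext fun i => hxy i _ hroot
  · funext v
    by_cases hv : v.1.1 ∈ S
    · exact hcut v.1 hv (by rw [v.2]; exact hroot)
    · exact c.msg_congr_of_cut hxy hcut v.1 hv

end TreeCode

/-- Every vertex is in `Child` of the root, so a cut containing the root would not be proper. -/
theorem IsValidCut.root_notMem {V : Type*} [Fintype V] [DecidableEq V] {T : RootedDirectedTree V}
    {S : Finset V} (hS : IsValidCut T S) : T.root ∉ S := fun h =>
  hS.1.ne (Finset.eq_univ_of_forall fun u => hS.2 _ h (T.path_root u))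

theorem log_card_msgSet_le {n : ℕ} {R : ℝ} (h : Nonempty (MsgSet n R)) :
    Real.log (Fintype.card (MsgSet n R)) ≤ n * (R * Real.log 2) := by
  have hpos : 0 < ⌊(2 : ℝ) ^ ((n : ℝ) * R)⌋₊ := Fin.pos_iff_nonempty.2 h
  rw [Fintype.card_fin, ← mul_assoc, ← Real.log_rpow two_pos]
  exact Real.log_le_log (by exact_mod_cast hpos) (Nat.floor_le (by positivity))

theorem theorem1 {V : Type*} [Fintype V] [DecidableEq V] (T : RootedDirectedTree V)
    {X : V → Type*} [∀ u, Fintype (X u)] {F : Type*}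
    (p : (∀ u, X u) → ℝ) (hp : p ∈ stdSimplex ℝ (∀ u, X u))
    (f : (∀ u, X u) → F) (R : T.NonRoot → ℝ) (hR : IsAchievable T p f R)
    (S : Finset V) (hS : IsValidCut T S) :
    condGraphEntropy (cutLaw p S) f ≤
      ∑ v : T.NonRoot with v.1 ∈ S ∧ T.out v ∉ S, R v := by
  classical
  set XS : (∀ u, X u) → ∀ u : {u : V // u ∈ S}, X u.1 := fun x u => x u.1 with hXS
  set XC : (∀ u, X u) → ∀ u : {u : V // u ∉ S}, X u.1 := fun x u => x u.1 with hXC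
  set glue : (∀ u : {u : V // u ∈ S}, X u.1) → (∀ u : {u : V // u ∉ S}, X u.1) → ∀ u, X u :=
    fun l k u => if hu : u ∈ S then l ⟨u, hu⟩ else k ⟨u, hu⟩ with hglue
  have hglue' : ∀ x, glue (XS x) (XC x) = x := fun x => by
    funext u
    by_cases hu : u ∈ S <;> simp [hglue, hXS, hXC, hu]
  have hlog2 := Real.log_pos one_lt_two
  have hmain : ∀ η > 0, condGraphEntropy (cutLaw p S) f * Real.log 2 ≤
      (∑ v : T.NonRoot with v.1 ∈ S ∧ T.out v ∉ S, R v) * Real.log 2 + η := by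
    intro η hη
    obtain ⟨ε, hε, hblock⟩ := exists_mul_condGraphEntropy_le (p := cutLaw p S) (f := f)
      (h := fun l k => f (glue l k)) hp (lawOf_nonneg hp.1 _) XS XC
      (by
        funext w
        rw [cutLaw, lawOf_lawOf])
      (by
        intro l k s hpos
        obtain ⟨x, hx, -⟩ := exists_of_lawOf_pos hp.1 hpos
        simp only [Prod.mk.injEq] at hx
        obtain ⟨rfl, rfl, rfl⟩ := hx
        exact congrArg f (hglue' x).symm) hη
    obtain ⟨n₀, hn₀⟩ := hR ε hε
    -- A single block length suffices, as ε does not depend on it; the successor ensures that it is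
    -- positive for the final division.
    obtain ⟨c, hc⟩ := hn₀ (n₀ + 1) n₀.le_succ
    have hb := hblock (n₀ + 1)
      (fun x (v : {v : T.NonRoot // v.1 ∈ S ∧ T.out v ∉ S}) => c.msg x v.1) c.output
      (fun x y hxy => funext fun v => c.msg_congr_of_child_subset (S := (S : Set V)) hS.2
        (fun i w hw => congrFun (hxy i) ⟨w, hw⟩) v.1 v.2.1)
      (fun x y hm hxy => c.output_congr_of_cut (S := (S : Set V)) hS.root_notMem
        (fun i w hw => congrFun (hxy i) ⟨w, hw⟩)
        fun v h1 h2 => congrFun hm ⟨v, h1, h2⟩)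
      (by
        simp only [hglue']
        exact hc)
    obtain ⟨x₀⟩ : Nonempty (∀ u, X u) := by
      by_contra hne
      rw [not_nonempty_iff] at hne
      simpa using hp.2
    -- A negative rate could make the floor zero, where log 0 = 0 breaks the cardinality bound; the
    -- existence of a code excludes this.
    have hne : ∀ v, Nonempty (MsgSet (n₀ + 1) (R v)) := fun v => ⟨c.msg (fun _ => x₀) v⟩
    have hcard : Real.log (Fintype.card
        (∀ v : {v : T.NonRoot // v.1 ∈ S ∧ T.out v ∉ S}, MsgSet (n₀ + 1) (R v.1))) ≤
        (n₀ + 1 : ℕ) * ((∑ v : T.NonRoot with v.1 ∈ S ∧ T.out v ∉ S, R v) * Real.log 2) := by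
      rw [Fintype.card_pi, Nat.cast_prod,
        Real.log_prod (fun v _ => by have := hne v.1; exact_mod_cast Fintype.card_ne_zero),
        ← Finset.sum_subtype_eq_sum_filter, Finset.sum_mul, Finset.mul_sum]
      refine (Finset.sum_le_sum fun v _ => log_card_msgSet_le (hne v.1)).trans_eq ?_
      exact Finset.sum_congr (by ext; simp) fun _ _ => rfl
    have hn : (0 : ℝ) < (n₀ + 1 : ℕ) := by positivity
    refine le_of_mul_le_mul_left ?_ hn
    rw [mul_add]
    linarith
  exact le_of_mul_le_mul_right (le_of_forall_pos_le_add hmain) hlog2
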